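/- Let $G=(V,E)$ be a simple graph, and for $x\in V$ let $N[x]=\{x\}\cup\{y\in V: xy\in E\}$ be its closed neighborhood. A (not necessarily proper) vertex coloring of $G$ is called conflict-free if for every $x\in V$ there is a vertex $y\in N[x]$ whose color is different from the color of each other vertex of $N[x]$. The conflict-free chromatic number $\chi_{CF}(G)$ is the smallest $r$ such that $G$ has a conflict-free coloring with $r$ colors. A set $S\subseteq V$ is dominating if each $v\in V$ is in $S$ or is adjacent to a vertex in $S$, and the domination number $D(G)$ is the smallest size of a dominating set of $G$. (Both numbers are taken in $\mathbb{N}\cup\{\infty\}$; for finite graphs they are finite.) Let $G(n,p)$ denote the binomial random graph on $n$ labeled vertices, in which each of the $\binom n2$ possible edges is present independently with probability $p$. Then every graph $G$ satisfies \[\chi_{CF}(G)\le D(G)+1.\] Furthermore, for every function $p=p(n)$ with $\frac12\le p(n)\le 1$ for all $n$, asymptotically almost surely \[D(G(n,p(n)))-3\le \chi_{CF}(G(n,p(n))),\] that is, the probability of this event tends to $1$ as $n\to\infty$. -/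

import Mathlib

namespace SimpleGraph

/-- The closed neighborhood `N[x] = N(x) ∪ {x}`. -/
def closedNeighborSet {V : Type*} (G : SimpleGraph V) (x : V) : Set V :=
  insert x (G.neighborSet x)

/-- A (not necessarily proper) vertex coloring `c` is conflict-free if for every vertex `x` there
is a vertex `y ∈ N[x]` whose color differs from the color of each other vertex of `N[x]`. -/
def IsConflictFree {V α : Type*} (G : SimpleGraph V) (c : V → α) : Prop :=
  ∀ x : V, ∃ y ∈ G.closedNeighborSet x, ∀ z ∈ G.closedNeighborSet x, z ≠ y → c z ≠ c y

/-- The conflict-free chromatic number: the smallest `r` such that there is a conflict-free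
coloring of `G` with `r` colors (`⊤` if there is none, which is impossible for finite graphs). -/
noncomputable def conflictFreeChromaticNumber {V : Type*} (G : SimpleGraph V) : ℕ∞ :=
  ⨅ (r : ℕ) (_ : ∃ c : V → Fin r, G.IsConflictFree c), (r : ℕ∞)

/-- `S` is a dominating set if each vertex is in `S` or is adjacent to a vertex of `S`. -/
def IsDominatingSet {V : Type*} (G : SimpleGraph V) (S : Set V) : Prop :=
  ∀ v : V, v ∈ S ∨ ∃ s ∈ S, G.Adj v s

/-- The domination number: the smallest size of a dominating set (`⊤` if there is no finite
dominating set, which is impossible for finite graphs). -/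
noncomputable def dominationNumber {V : Type*} (G : SimpleGraph V) : ℕ∞ :=
  ⨅ (S : Set V) (_ : G.IsDominatingSet S), S.encard

end SimpleGraph

open MeasureTheory ProbabilityTheory

namespace SimpleGraph

/-! Upper bound: give each vertex of a dominating set a private color and all other vertices one
common color.

Lower bound: put q = 1 - p and n + 1 = e^L, and let r be a point where n q^r falls below about (7/2)
r L (`exists_crossover`). Two estimates meet there. No conflict-free coloring with r colors exists,
with high probability (`binomialRandom_real_exists_isConflictFree_le`). Up to three vertices of each
color class already constrain every vertex outside these samples, and such a vertex violates the
constraints with probability at least q^r. Sampling leaves only (n+1)^(3r) cases for the union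
bound, instead of r^n colorings. A dominating set of size d = r + 4 exists, with high probability
(`le_binomialRandom_real_dominationNumber_le`), by the second moment method. It is applied only to
transversals of d disjoint blocks, so that the sum over pairs factorizes. Together, D ≤ r + 4 = (r +
1) + 3 ≤ χ_CF + 3. -/

theorem conflictFreeChromaticNumber_le_dominationNumber_add_one {V : Type*} (G : SimpleGraph V) :
    G.conflictFreeChromaticNumber ≤ G.dominationNumber + 1 := by
  classical
  unfold dominationNumber
  rw [ENat.iInf_add]
  refine le_iInf fun S => ?_
  rw [ENat.iInf_add]
  refine le_iInf fun hS => ?_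
  by_cases hfin : S.Finite
  swap
  -- For infinite `S` the right side is `⊤`.
  · simp [Set.encard_eq_top_iff.2 hfin]
  have : Fintype S := hfin.fintype
  let e := Fintype.equivFin S
  have hcard : S.encard = (Fintype.card S : ℕ∞) := by
    rw [Set.encard_eq_coe_toFinset_card, Set.toFinset_card]
  rw [hcard]
  refine iInf₂_le_of_le (Fintype.card S + 1)
    ⟨fun v => if h : v ∈ S then (e ⟨v, h⟩).castSucc else Fin.last _, ?_⟩ (by simp)
  intro x
  have key : ∀ s ∈ S, ∀ z, z ≠ s →
      (if h : z ∈ S then (e ⟨z, h⟩).castSucc else Fin.last _) ≠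
        (if h : s ∈ S then (e ⟨s, h⟩).castSucc else Fin.last _) := by
    intro s hs z hz
    rw [dif_pos hs]
    split_ifs with h
    · intro h'
      exact hz (by simpa using h')
    · exact (Fin.castSucc_lt_last _).ne'
  rcases hS x with hx | ⟨s, hs, hxs⟩
  · exact ⟨x, by simp [closedNeighborSet], fun z _ hz => key x hx z hz⟩
  · exact ⟨s, by simp [closedNeighborSet, hxs], fun z _ hz => key s hs z hz⟩

/-! ### Independence of events on disjoint edge sets -/

section EdgeIndependence

/-- The event `A` only depends on the presence of the edges in `S`. -/
def DependsOnEdges {V : Type*} (S : Finset (Sym2 V)) (A : Set (SimpleGraph V)) : Prop :=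
  ∀ ⦃G H : SimpleGraph V⦄, (∀ e ∈ S, e ∈ G.edgeSet ↔ e ∈ H.edgeSet) → G ∈ A → H ∈ A

/-- Puts the event in the form to which independence of the edge indicators applies. -/
theorem DependsOnEdges.eq_preimage {V : Type*} {S : Finset (Sym2 V)} {A : Set (SimpleGraph V)}
    (h : DependsOnEdges S A) :
    A = (fun G (e : S) => (e : Sym2 V) ∈ G.edgeSet) ⁻¹'
      ((fun G (e : S) => (e : Sym2 V) ∈ G.edgeSet) '' A) := by
  refine Set.Subset.antisymm (Set.subset_preimage_image _ _) ?_
  rintro G ⟨H, hH, hHG⟩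
  refine h (fun e he => ?_) hH
  have := congrFun hHG ⟨e, he⟩
  simpa using this

variable {V : Type*} [Finite V] (p : unitInterval)

instance : MeasurableSingletonClass (SimpleGraph V) where
  measurableSet_singleton G := by
    have h : ({G} : Set (SimpleGraph V)) = edgeSet ⁻¹' {G.edgeSet} := by
      ext H; simp
    rw [h]
    refine measurable_edgeSet ?_
    have h' : ({G.edgeSet} : Set (Set (Sym2 V))) =
        MeasurableEquiv.setOfPred.symm ⁻¹' {fun e => e ∈ G.edgeSet} := by
      ext s
      simp [MeasurableEquiv.setOfPred, funext_iff, Set.ext_iff]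
    rw [h']
    exact MeasurableEquiv.setOfPred.symm.measurable (measurableSet_singleton _)

/-- The edge indicators of a binomial random graph are distributed as independent coins. -/
theorem map_edge_binomialRandom :
    (binomialRandom V p).map (fun G (e : Sym2 V) => e ∈ G.edgeSet) =
      Measure.infinitePi (fun e : Sym2 V => unitInterval.toNNReal p • .dirac (¬ e.IsDiag) +
        unitInterval.toNNReal (unitInterval.symm p) • .dirac False) := by
  have hm : Measurable (fun (G : SimpleGraph V) (e : Sym2 V) => e ∈ G.edgeSet) :=
    measurable_of_countable _
  ext B hB
  rw [Measure.map_apply hm hB, binomialRandom_apply, Set.image_preimage_eq_inter_range]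
  -- Total mass 1 shows that edge vectors of actual graphs carry the whole product measure.
  have h1 := binomialRandom_apply (V := V) p Set.univ
  rw [measure_univ, Set.image_univ] at h1
  exact measure_inter_conull ((prob_compl_eq_zero_iff (Set.toFinite _).measurableSet).2 h1.symm)

theorem iIndepFun_edge_binomialRandom :
    iIndepFun (fun (e : Sym2 V) (G : SimpleGraph V) => e ∈ G.edgeSet) (binomialRandom V p) := by
  have hm : Measurable (fun (G : SimpleGraph V) (e : Sym2 V) => e ∈ G.edgeSet) :=
    measurable_of_countable _
  rw [iIndepFun_iff_map_fun_eq_infinitePi_map (fun e => measurable_of_countable _),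
    map_edge_binomialRandom]
  congr 1
  ext1 e
  rw [← Measure.infinitePi_map_eval (fun e : Sym2 V =>
    unitInterval.toNNReal p • Measure.dirac (¬ e.IsDiag) +
        unitInterval.toNNReal (unitInterval.symm p) • Measure.dirac False) e,
    ← map_edge_binomialRandom, Measure.map_map (by fun_prop) hm]
  rfl

theorem binomialRandom_real_adj {x y : V} (hxy : x ≠ y) :
    (binomialRandom V p).real {G | G.Adj x y} = p := by
  have hm : Measurable (fun (G : SimpleGraph V) (e : Sym2 V) => e ∈ G.edgeSet) :=
    measurable_of_countable _
  have h := congrArg (fun μ => (μ.map (Function.eval s(x, y))).real {True})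
    (map_edge_binomialRandom (V := V) p)
  simp only [Measure.infinitePi_map_eval] at h
  rw [Measure.map_map (by fun_prop) hm, measureReal_def, Measure.map_apply
    (by fun_prop) (measurableSet_singleton _)] at h
  rw [measureReal_def]
  convert h using 2
  · congr 1
    ext G
    simp
  · simp [measureReal_def, hxy, Set.indicator]

theorem binomialRandom_real_not_adj {x y : V} (hxy : x ≠ y) :
    (binomialRandom V p).real {G | ¬ G.Adj x y} = 1 - p := by
  have := probReal_compl_eq_one_sub (μ := binomialRandom V p)
    (MeasurableSet.of_discrete (s := {G : SimpleGraph V | G.Adj x y}))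
  rwa [binomialRandom_real_adj p hxy] at this

theorem binomialRandom_real_inter {S T : Finset (Sym2 V)} (hST : Disjoint S T)
    {A B : Set (SimpleGraph V)} (hA : DependsOnEdges S A) (hB : DependsOnEdges T B) :
    (binomialRandom V p).real (A ∩ B) =
      (binomialRandom V p).real A * (binomialRandom V p).real B := by
  have h := (iIndepFun_edge_binomialRandom (V := V) p).indepFun_finset S T hST
    (fun e => measurable_of_countable _)
  have h2 := h.measure_inter_preimage_eq_mul _ _
    (Set.toFinite ((fun G (e : S) => (e : Sym2 V) ∈ G.edgeSet) '' A)).measurableSet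
    (Set.toFinite ((fun G (e : T) => (e : Sym2 V) ∈ G.edgeSet) '' B)).measurableSet
  rw [← hA.eq_preimage, ← hB.eq_preimage] at h2
  rw [measureReal_def, h2, ENNReal.toReal_mul]
  rfl

theorem binomialRandom_real_biInter {ι : Type*} (s : Finset ι) (S : ι → Finset (Sym2 V))
    (hS : (s : Set ι).PairwiseDisjoint S) (A : ι → Set (SimpleGraph V))
    (hA : ∀ i ∈ s, DependsOnEdges (S i) (A i)) :
    (binomialRandom V p).real (⋂ i ∈ s, A i) = ∏ i ∈ s, (binomialRandom V p).real (A i) := by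
  classical
  induction s using Finset.induction_on with
  | empty => simp
  | insert a s ha ih =>
    rw [Finset.prod_insert ha, Finset.set_biInter_insert, ← ih
      (hS.subset (by simp)) (fun i hi => hA i (Finset.mem_insert_of_mem hi))]
    refine binomialRandom_real_inter p (S := S a) (T := s.biUnion S) ?_
      (hA a (Finset.mem_insert_self _ _)) ?_
    · rw [Finset.disjoint_biUnion_right]
      intro i hi
      exact hS (by simp) (by simp [hi]) (by rintro rfl; exact ha hi)
    · intro G H hGH hG
      simp only [Set.mem_iInter] at hG ⊢
      exact fun i hi => hA i (Finset.mem_insert_of_mem hi)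
        (fun e he => hGH e (Finset.mem_biUnion.2 ⟨i, hi, he⟩)) (hG i hi)

end EdgeIndependence

/-! ### Edges from one vertex to a set -/

section Star

variable {V : Type*} [DecidableEq V]

/-- The possible edges between `x` and the vertices of `T`. -/
def star (x : V) (T : Finset V) : Finset (Sym2 V) := T.image fun u => s(x, u)

theorem disjoint_star_left {x : V} {S T : Finset V} (h : Disjoint S T) :
    Disjoint (star x S) (star x T) := by
  simp only [star, Finset.disjoint_left, Finset.mem_image] at h ⊢
  rintro _ ⟨u, hu, rfl⟩ ⟨v, hv, hvu⟩
  rw [Sym2.congr_right] at hvu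
  exact h hu (hvu ▸ hv)

theorem disjoint_star_of_notMem {x y : V} {U : Finset V} (hxy : x ≠ y) (hx : x ∉ U) :
    Disjoint (star x U) (star y U) := by
  simp only [star, Finset.disjoint_left, Finset.mem_image]
  rintro _ ⟨u, hu, rfl⟩ ⟨v, hv, hvu⟩
  rw [Sym2.eq_iff] at hvu
  rcases hvu with ⟨h, -⟩ | ⟨-, h⟩
  · exact hxy h.symm
  · exact hx (h ▸ hv)

theorem dependsOnEdges_star {x : V} {T : Finset V} {A : Set (SimpleGraph V)}
    (h : ∀ ⦃G H : SimpleGraph V⦄, (∀ u ∈ T, G.Adj x u ↔ H.Adj x u) → G ∈ A → H ∈ A) :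
    DependsOnEdges (star x T) A := fun G H hGH => h fun u hu => by
  simpa using hGH s(x, u) (Finset.mem_image_of_mem _ hu)

variable [Finite V] (p : unitInterval)

theorem binomialRandom_real_forall_not_adj {x : V} {T : Finset V} (hx : x ∉ T) :
    (binomialRandom V p).real {G | ∀ u ∈ T, ¬ G.Adj x u} = (1 - p : ℝ) ^ T.card := by
  have h := binomialRandom_real_biInter p T (fun u => star x {u})
    (fun u _ v _ huv => disjoint_star_left (by simpa using huv)) (fun u => {G | ¬ G.Adj x u})
    (fun u _ => dependsOnEdges_star fun G H hGH => by simp [hGH u (by simp)])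
  rw [Finset.prod_congr rfl (fun u hu => binomialRandom_real_not_adj p
    (x := x) (y := u) (by rintro rfl; exact hx hu)), Finset.prod_const] at h
  rw [← h]
  congr 1
  ext G
  simp

/-- Vertices outside `U` attach to `U` independently of each other. -/
theorem binomialRandom_real_forall_notMem [Fintype V] (U : Finset V)
    (A : V → Set (SimpleGraph V))
    (hA : ∀ x ∉ U, ∀ ⦃G H : SimpleGraph V⦄, (∀ u ∈ U, G.Adj x u ↔ H.Adj x u) → G ∈ A x → H ∈ A x) :
    (binomialRandom V p).real {G | ∀ x ∉ U, G ∈ A x} =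
      ∏ x ∈ Uᶜ, (binomialRandom V p).real (A x) := by
  rw [← binomialRandom_real_biInter p Uᶜ (fun x => star x U)
    (fun x hx y _ hxy => disjoint_star_of_notMem hxy (by simpa using hx)) A
    (fun x hx => dependsOnEdges_star (hA x (by simpa using hx)))]
  congr 1
  ext G
  simp

end Star

/-! ### Few colors do not suffice -/

section ConflictFree

variable {V : Type*}

open Classical in
/-- The necessary condition that a set `T` of at most three vertices of a color class imposes on
the neighborhood of a vertex `x ∉ T` which sees exactly one vertex of that class, where `T` is the
whole class if it has at most two vertices. -/
def SeesUnique (G : SimpleGraph V) (x : V) (T : Finset V) : Prop :=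
  (T.filter (G.Adj x)).card ≤ 1 ∧ (T.card ≤ 2 → (T.filter (G.Adj x)).card = 1)

theorem SeesUnique.congr {G H : SimpleGraph V} {x : V} {T : Finset V}
    (h : ∀ u ∈ T, G.Adj x u ↔ H.Adj x u) : G.SeesUnique x T ↔ H.SeesUnique x T := by
  classical
  unfold SeesUnique
  rw [Finset.filter_congr h]

variable [DecidableEq V]

/-- With q = 1 - p, the failure probability for sizes 0, 1, 2, 3 is 1, q, p² + q², p² + 2p²q, each
at least q because p ≥ 1/2. Three samples are needed from a large class: two would give only p²,
which is below q at p = 1/2. -/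
theorem binomialRandom_real_not_seesUnique [Finite V] (p : unitInterval) (hp : (1 / 2 : ℝ) ≤ p)
    {x : V} {T : Finset V} (hx : x ∉ T) (hT : T.card ≤ 3) :
    (1 - p : ℝ) ≤ (binomialRandom V p).real {G | ¬ G.SeesUnique x T} := by
  classical
  have hp0 : (0 : ℝ) ≤ p := p.2.1
  have hp1 : (p : ℝ) ≤ 1 := p.2.2
  have dep : ∀ (a : V) (b : Prop), DependsOnEdges (star x {a})
      {G : SimpleGraph V | G.Adj x a ↔ b} := fun a b =>
    dependsOnEdges_star fun G H hGH => by simp [hGH a (by simp)]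
  have pT : ∀ a, x ≠ a → (binomialRandom V p).real {G | G.Adj x a ↔ True} = p := fun a ha => by
    simpa using binomialRandom_real_adj p ha
  have pF : ∀ a, x ≠ a → (binomialRandom V p).real {G | G.Adj x a ↔ False} = 1 - p :=
    fun a ha => by simpa using binomialRandom_real_not_adj p ha
  have two : ∀ (a b : V) (s t : Prop), a ≠ b → (binomialRandom V p).real
      ({G | G.Adj x a ↔ s} ∩ {G | G.Adj x b ↔ t}) =
      (binomialRandom V p).real {G | G.Adj x a ↔ s} *
        (binomialRandom V p).real {G | G.Adj x b ↔ t} := fun a b s t hab =>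
    binomialRandom_real_inter p (disjoint_star_left (by simpa using hab)) (dep a s) (dep b t)
  have hcases : T.card = 0 ∨ T.card = 1 ∨ T.card = 2 ∨ T.card = 3 := by omega
  rcases hcases with h | h | h | h
  · obtain rfl := Finset.card_eq_zero.1 h
    simp [SeesUnique, hp0]
  · obtain ⟨a, rfl⟩ := Finset.card_eq_one.1 h
    rw [← pF a (by simpa using hx)]
    refine measureReal_mono fun G hG => ?_
    have hG' : ¬ G.Adj x a := by simpa using hG
    simp [SeesUnique, Finset.filter_singleton, hG']
  · obtain ⟨a, b, hab, rfl⟩ := Finset.card_eq_two.1 h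
    have hxa : x ≠ a := by rintro rfl; simp at hx
    have hxb : x ≠ b := by rintro rfl; simp at hx
    have hsub : ({G | G.Adj x a ↔ True} ∩ {G | G.Adj x b ↔ True}) ∪
        ({G | G.Adj x a ↔ False} ∩ {G | G.Adj x b ↔ False}) ⊆
          {G : SimpleGraph V | ¬ G.SeesUnique x {a, b}} := by
      rintro G (⟨h1, h2⟩ | ⟨h1, h2⟩) <;>
      simp only [Set.mem_ofPred_eq, iff_true, iff_false] at h1 h2 <;>
      simp [SeesUnique, Finset.filter_insert, Finset.filter_singleton, h1, h2, hab]
    refine le_trans ?_ (measureReal_mono hsub)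
    rw [measureReal_union _ MeasurableSet.of_discrete, two _ _ _ _ hab, two _ _ _ _ hab,
      pT a hxa, pT b hxb, pF a hxa, pF b hxb]
    · nlinarith
    · rw [Set.disjoint_left]
      rintro G ⟨h1, -⟩ ⟨h2, -⟩
      simp_all
  · obtain ⟨a, b, c, hab, hac, hbc, rfl⟩ := Finset.card_eq_three.1 h
    have hxa : x ≠ a := by rintro rfl; simp at hx
    have hxb : x ≠ b := by rintro rfl; simp at hx
    have hxc : x ≠ c := by rintro rfl; simp at hx
    have three : ∀ (s t u : Prop), (binomialRandom V p).real
        ({G | G.Adj x a ↔ s} ∩ ({G | G.Adj x b ↔ t} ∩ {G | G.Adj x c ↔ u})) =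
        (binomialRandom V p).real {G | G.Adj x a ↔ s} *
          ((binomialRandom V p).real {G | G.Adj x b ↔ t} *
            (binomialRandom V p).real {G | G.Adj x c ↔ u}) := fun s t u => by
      rw [← two _ _ _ _ hbc]
      refine binomialRandom_real_inter p (T := star x {b, c})
        (disjoint_star_left (by simp [hab, hac])) (dep a s) ?_
      exact dependsOnEdges_star fun G H hGH => by simp [hGH b (by simp), hGH c (by simp)]
    have hsub : ({G | G.Adj x a ↔ True} ∩ {G | G.Adj x b ↔ True}) ∪
        (({G | G.Adj x a ↔ True} ∩ ({G | G.Adj x b ↔ False} ∩ {G | G.Adj x c ↔ True})) ∪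
        ({G | G.Adj x a ↔ False} ∩ ({G | G.Adj x b ↔ True} ∩ {G | G.Adj x c ↔ True}))) ⊆
          {G : SimpleGraph V | ¬ G.SeesUnique x {a, b, c}} := by
      rintro G (⟨h1, h2⟩ | ⟨h1, h2, h3⟩ | ⟨h1, h2, h3⟩) hG
      · have : ({a, b} : Finset V).card ≤ 1 :=
          (Finset.card_le_card fun u hu => by
            simp only [Finset.mem_insert, Finset.mem_singleton] at hu
            rcases hu with rfl | rfl <;> simp_all).trans hG.1
        simp [Finset.card_pair hab] at this
      · have : ({a, c} : Finset V).card ≤ 1 :=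
          (Finset.card_le_card fun u hu => by
            simp only [Finset.mem_insert, Finset.mem_singleton] at hu
            rcases hu with rfl | rfl <;> simp_all).trans hG.1
        simp [Finset.card_pair hac] at this
      · have : ({b, c} : Finset V).card ≤ 1 :=
          (Finset.card_le_card fun u hu => by
            simp only [Finset.mem_insert, Finset.mem_singleton] at hu
            rcases hu with rfl | rfl <;> simp_all).trans hG.1
        simp [Finset.card_pair hbc] at this
    refine le_trans ?_ (measureReal_mono hsub)
    rw [measureReal_union _ MeasurableSet.of_discrete, measureReal_union _ MeasurableSet.of_discrete,
      two _ _ _ _ hab, three, three, pT a hxa, pT b hxb, pT c hxc, pF a hxa, pF b hxb]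
    · nlinarith [mul_nonneg hp0 (sub_nonneg.2 hp), mul_nonneg (sub_nonneg.2 hp1) (sub_nonneg.2 hp),
        mul_nonneg hp0 (mul_nonneg (sub_nonneg.2 hp1) (sub_nonneg.2 hp))]
    · rw [Set.disjoint_left]
      rintro G ⟨h1, -⟩ ⟨h2, -⟩
      simp_all
    · rw [Set.disjoint_left]
      rintro G ⟨h1, h1'⟩ (⟨h2, h2', -⟩ | ⟨h2, h2', -⟩) <;> simp_all

/-- The disjoint `T i` involve different edges at `x`, so the r failures are independent. -/
theorem binomialRandom_real_exists_seesUnique_le [Finite V] (p : unitInterval)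
    (hp : (1 / 2 : ℝ) ≤ p) {r : ℕ} {x : V} {T : Fin r → Finset V}
    (hx : ∀ i, x ∉ T i) (hT : ∀ i, (T i).card ≤ 3) (hd : Pairwise (Function.onFun Disjoint T)) :
    (binomialRandom V p).real {G | ∃ i, G.SeesUnique x (T i)} ≤ 1 - (1 - p : ℝ) ^ r := by
  have hp1 : (p : ℝ) ≤ 1 := p.2.2
  have h := binomialRandom_real_biInter p Finset.univ (fun i => star x (T i))
    (fun i _ j _ hij => disjoint_star_left (hd hij)) (fun i => {G | ¬ G.SeesUnique x (T i)})
    (fun i _ => dependsOnEdges_star fun G H hGH => by simp [SeesUnique.congr hGH])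
  have h2 : (1 - p : ℝ) ^ r ≤
      ∏ i, (binomialRandom V p).real {G | ¬ G.SeesUnique x (T i)} := by
    calc (1 - p : ℝ) ^ r = ∏ _i : Fin r, (1 - p : ℝ) := by simp
      _ ≤ _ := Finset.prod_le_prod (fun _ _ => by linarith)
        (fun i _ => binomialRandom_real_not_seesUnique p hp (hx i) (hT i))
  rw [← h] at h2
  have h3 := probReal_compl_eq_one_sub (μ := binomialRandom V p)
    (MeasurableSet.of_discrete (s := {G : SimpleGraph V | ∃ i, G.SeesUnique x (T i)}))
  have h4 : {G : SimpleGraph V | ∃ i, G.SeesUnique x (T i)}ᶜ =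
      ⋂ i ∈ (Finset.univ : Finset (Fin r)), {G | ¬ G.SeesUnique x (T i)} := by
    ext G; simp
  rw [h4] at h3
  linarith

theorem binomialRandom_real_forall_exists_seesUnique_le [Fintype V] (p : unitInterval)
    (hp : (1 / 2 : ℝ) ≤ p) {r : ℕ} {T : Fin r → Finset V}
    (hT : ∀ i, (T i).card ≤ 3) (hd : Pairwise (Function.onFun Disjoint T)) :
    (binomialRandom V p).real
      {G | ∀ x ∉ Finset.univ.biUnion T, ∃ i, G.SeesUnique x (T i)} ≤
        (1 - (1 - p : ℝ) ^ r) ^ (Fintype.card V - 3 * r) := by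
  have hp0 : (0 : ℝ) ≤ p := p.2.1
  have hp1 : (p : ℝ) ≤ 1 := p.2.2
  have hq0 : (0 : ℝ) ≤ (1 - p : ℝ) ^ r := pow_nonneg (by linarith) _
  have hq1 : (1 - p : ℝ) ^ r ≤ 1 := pow_le_one₀ (by linarith) (by linarith)
  have h := binomialRandom_real_forall_notMem p (Finset.univ.biUnion T)
    (fun x => {G | ∃ i, G.SeesUnique x (T i)}) (by
      rintro x - G H hGH ⟨i, hi⟩
      exact ⟨i, (SeesUnique.congr fun u hu => hGH u
        (Finset.mem_biUnion.2 ⟨i, Finset.mem_univ _, hu⟩)).1 hi⟩)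
  simp only [Set.mem_ofPred_eq] at h
  rw [h]
  have hU : (Finset.univ.biUnion T).card ≤ 3 * r := by
    refine Finset.card_biUnion_le.trans ((Finset.sum_le_sum fun i _ => hT i).trans ?_)
    simp [mul_comm]
  calc _ ≤ ∏ _x ∈ (Finset.univ.biUnion T)ᶜ, (1 - (1 - p : ℝ) ^ r) :=
        Finset.prod_le_prod (fun _ _ => measureReal_nonneg) fun x hx =>
          binomialRandom_real_exists_seesUnique_le p hp (by simpa using hx) hT hd
    _ = (1 - (1 - p : ℝ) ^ r) ^ (Fintype.card V - (Finset.univ.biUnion T).card) := by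
        rw [Finset.prod_const, Finset.card_compl]
    _ ≤ _ := pow_le_pow_of_le_one (by linarith) (by linarith) (by omega)

theorem card_filter_card_le_three [Fintype V] :
    (Finset.univ.filter fun T : Finset V => T.card ≤ 3).card ≤ (Fintype.card V + 1) ^ 3 := by
  have hsub : (Finset.univ.filter fun T : Finset V => T.card ≤ 3) ⊆
      (Finset.range 4).biUnion fun k => Finset.powersetCard k Finset.univ := by
    intro T hT
    simp only [Finset.mem_filter, Finset.mem_univ, true_and] at hT
    simp only [Finset.mem_biUnion, Finset.mem_range, Finset.mem_powersetCard_univ]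
    exact ⟨_, by omega, rfl⟩
  refine (Finset.card_le_card hsub).trans (Finset.card_biUnion_le.trans ?_)
  simp only [Finset.card_powersetCard, Finset.card_univ]
  -- The sum becomes 1 + n + n² + n³ ≤ (n + 1)³.
  refine (Finset.sum_le_sum fun k _ => Nat.choose_le_pow (Fintype.card V) k).trans ?_
  simp only [Finset.sum_range_succ, Finset.sum_range_zero]
  nlinarith [sq_nonneg (Fintype.card V)]

/-- Take `T i` to be the whole color class if it has at most two vertices, and any three of its
vertices otherwise. -/
theorem IsConflictFree.exists_seesUnique [Fintype V] {G : SimpleGraph V} {r : ℕ} {c : V → Fin r}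
    (hc : G.IsConflictFree c) :
    ∃ T : Fin r → Finset V, (∀ i, (T i).card ≤ 3) ∧ Pairwise (Function.onFun Disjoint T) ∧
      ∀ x ∉ Finset.univ.biUnion T, ∃ i, G.SeesUnique x (T i) := by
  classical
  have hex : ∀ i, ∃ T ⊆ Finset.univ.filter (fun v => c v = i), T.card ≤ 3 ∧
      (T.card ≤ 2 → T = Finset.univ.filter fun v => c v = i) := by
    intro i
    by_cases h : (Finset.univ.filter fun v => c v = i).card ≤ 2
    · exact ⟨_, subset_rfl, by omega, fun _ => rfl⟩
    · obtain ⟨T, hT, hT'⟩ := Finset.exists_subset_card_eq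
        (show 3 ≤ (Finset.univ.filter fun v => c v = i).card by omega)
      exact ⟨T, hT, hT'.le, by omega⟩
  choose T hT hT3 hTeq using hex
  have hcol : ∀ i, ∀ v ∈ T i, c v = i := fun i v hv => by simpa using hT i hv
  refine ⟨T, hT3, ?_, ?_⟩
  · intro i j hij
    refine Finset.disjoint_left.2 fun v hv hv' => hij ?_
    rw [← hcol i v hv, hcol j v hv']
  · intro x hx
    obtain ⟨y, hy, hyz⟩ := hc x
    refine ⟨c y, ?_, ?_⟩
    · rw [Finset.card_le_one]
      have key : ∀ z ∈ (T (c y)).filter (G.Adj x), z = y := by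
        intro z hz
        rw [Finset.mem_filter] at hz
        by_contra hzy
        exact hyz z (by simp [closedNeighborSet, hz.2]) hzy (hcol _ z hz.1)
      intro a ha b hb
      rw [key a ha, key b hb]
    · intro h2
      have hyT : y ∈ T (c y) := by rw [hTeq _ h2]; simp
      rw [Finset.card_eq_one]
      refine ⟨y, ?_⟩
      ext z
      simp only [Finset.mem_filter, Finset.mem_singleton]
      constructor
      · rintro ⟨hz, hxz⟩
        by_contra hzy
        exact hyz z (by simp [closedNeighborSet, hxz]) hzy (hcol _ z hz)
      · rintro rfl
        refine ⟨hyT, ?_⟩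
        -- The uniquely colored vertex could be `x` itself only if `x` lay in its own small class,
        -- which is excluded.
        rcases hy with rfl | hy
        · exact absurd (Finset.mem_biUnion.2 ⟨_, Finset.mem_univ _, hyT⟩) hx
        · exact hy

theorem binomialRandom_real_exists_isConflictFree_le [Fintype V] (p : unitInterval)
    (hp : (1 / 2 : ℝ) ≤ p) (r : ℕ) :
    (binomialRandom V p).real {G | ∃ c : V → Fin r, G.IsConflictFree c} ≤
      ((Fintype.card V + 1 : ℝ) ^ 3) ^ r *
        (1 - (1 - p : ℝ) ^ r) ^ (Fintype.card V - 3 * r) := by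
  classical
  have hp0 : (0 : ℝ) ≤ p := p.2.1
  have hp1 : (p : ℝ) ≤ 1 := p.2.2
  have hq1 : (1 - p : ℝ) ^ r ≤ 1 := pow_le_one₀ (by linarith) (by linarith)
  set F : Finset (Fin r → Finset V) := (Fintype.piFinset fun _ : Fin r =>
    Finset.univ.filter fun T : Finset V => T.card ≤ 3).filter
      fun T => Pairwise (Function.onFun Disjoint T) with hF
  have hcard : (F.card : ℝ) ≤ ((Fintype.card V + 1 : ℝ) ^ 3) ^ r := by
    have h1 : F.card ≤ ((Fintype.card V + 1) ^ 3) ^ r := by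
      refine (Finset.card_filter_le _ _).trans ?_
      rw [Fintype.card_piFinset_const]
      exact Nat.pow_le_pow_left card_filter_card_le_three r
    exact_mod_cast h1
  have hsub : {G : SimpleGraph V | ∃ c : V → Fin r, G.IsConflictFree c} ⊆
      ⋃ T ∈ F, {G | ∀ x ∉ Finset.univ.biUnion T, ∃ i, G.SeesUnique x (T i)} := by
    rintro G ⟨c, hc⟩
    obtain ⟨T, h3, hd, hT⟩ := hc.exists_seesUnique
    simp only [Set.mem_iUnion]
    exact ⟨T, by simp [hF, h3, hd], hT⟩
  calc _ ≤ _ := measureReal_mono hsub (measure_ne_top _ _)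
    _ ≤ ∑ T ∈ F, _ := measureReal_biUnion_finset_le _ _
    _ ≤ ∑ _T ∈ F, (1 - (1 - p : ℝ) ^ r) ^ (Fintype.card V - 3 * r) := by
      refine Finset.sum_le_sum fun T hT => ?_
      simp only [hF, Finset.mem_filter, Fintype.mem_piFinset, Finset.mem_univ, true_and] at hT
      exact binomialRandom_real_forall_exists_seesUnique_le p hp hT.1 hT.2
    _ = F.card * (1 - (1 - p : ℝ) ^ r) ^ (Fintype.card V - 3 * r) := by simp
    _ ≤ _ := mul_le_mul_of_nonneg_right hcard (pow_nonneg (by linarith) _)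

end ConflictFree

end SimpleGraph

/-! ### Second moment inequality -/

/-- The second moment method for the number of events of a family that occur. -/
theorem sq_sum_measureReal_le {Ω ι : Type*} [MeasurableSpace Ω] (μ : Measure Ω)
    [IsProbabilityMeasure μ] (s : Finset ι) (A : ι → Set Ω) (hA : ∀ i ∈ s, MeasurableSet (A i)) :
    (∑ i ∈ s, μ.real (A i)) ^ 2 ≤
      μ.real (⋃ i ∈ s, A i) * ∑ i ∈ s, ∑ j ∈ s, μ.real (A i ∩ A j) := by
  classical
  set B := ⋃ i ∈ s, A i with hB
  have hBm : MeasurableSet B := Finset.measurableSet_biUnion s hA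
  have ind : ∀ C : Set Ω, MeasurableSet C → Integrable (C.indicator (fun _ => (1 : ℝ))) μ :=
    fun C hC => (integrable_const 1).indicator hC
  -- This is E(t·1_B - X)² ≥ 0, where X counts the events that occur and X = X·1_B; the discriminant
  -- then gives Cauchy–Schwarz.
  have key : ∀ t : ℝ, 0 ≤ μ.real B * (t * t) + (-2 * ∑ i ∈ s, μ.real (A i)) * t +
      ∑ i ∈ s, ∑ j ∈ s, μ.real (A i ∩ A j) := by
    intro t
    have hpt : ∀ ω, (t * B.indicator (fun _ => (1 : ℝ)) ω -
        ∑ i ∈ s, (A i).indicator (fun _ => (1 : ℝ)) ω) ^ 2 =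
        (t * t) * B.indicator (fun _ => (1 : ℝ)) ω +
          (-2 * t) * ∑ i ∈ s, (A i).indicator (fun _ => (1 : ℝ)) ω +
            ∑ i ∈ s, ∑ j ∈ s, (A i ∩ A j).indicator (fun _ => (1 : ℝ)) ω := by
      intro ω
      have h1 : ∀ i j, (A i ∩ A j).indicator (fun _ => (1 : ℝ)) ω =
          (A i).indicator (fun _ => (1 : ℝ)) ω * (A j).indicator (fun _ => (1 : ℝ)) ω := by
        intro i j
        simp only [Set.indicator_apply, Set.mem_inter_iff]
        split_ifs <;> simp_all
      simp only [h1]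
      rw [← Finset.sum_mul_sum]
      by_cases hω : ω ∈ B
      · rw [Set.indicator_of_mem hω]
        ring
      · have h0 : ∑ i ∈ s, (A i).indicator (fun _ => (1 : ℝ)) ω = 0 := by
          refine Finset.sum_eq_zero fun i hi => Set.indicator_of_notMem (fun h => hω ?_) _
          exact Set.mem_biUnion hi h
        rw [Set.indicator_of_notMem hω, h0]
        ring
    have hnn : 0 ≤ ∫ ω, (t * B.indicator (fun _ => (1 : ℝ)) ω -
        ∑ i ∈ s, (A i).indicator (fun _ => (1 : ℝ)) ω) ^ 2 ∂μ :=
      integral_nonneg fun ω => sq_nonneg _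
    have i1 : Integrable (fun ω => ∑ i ∈ s, (A i).indicator (fun _ => (1 : ℝ)) ω) μ :=
      integrable_finsetSum _ fun i hi => ind _ (hA i hi)
    have i2 : Integrable (fun ω =>
        ∑ i ∈ s, ∑ j ∈ s, (A i ∩ A j).indicator (fun _ => (1 : ℝ)) ω) μ :=
      integrable_finsetSum _ fun i hi => integrable_finsetSum _ fun j hj =>
        ind _ ((hA i hi).inter (hA j hj))
    have i3 : Integrable (fun ω => (t * t) * B.indicator (fun _ => (1 : ℝ)) ω +
        (-2 * t) * ∑ i ∈ s, (A i).indicator (fun _ => (1 : ℝ)) ω) μ :=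
      ((ind B hBm).const_mul _).add (i1.const_mul _)
    simp only [hpt] at hnn
    rw [integral_add i3 i2,
      integral_add ((ind B hBm).const_mul _) (i1.const_mul _), integral_const_mul,
      integral_const_mul, integral_finsetSum _ fun i hi => ind _ (hA i hi),
      integral_finsetSum _ fun i hi => integrable_finsetSum _ fun j hj =>
        ind _ ((hA i hi).inter (hA j hj)), integral_indicator_const _ hBm] at hnn
    have e1 : ∑ i ∈ s, ∫ ω, (A i).indicator (fun _ => (1 : ℝ)) ω ∂μ = ∑ i ∈ s, μ.real (A i) :=
      Finset.sum_congr rfl fun i hi => by rw [integral_indicator_const _ (hA i hi)]; simp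
    have e2 : ∑ i ∈ s, ∫ ω, ∑ j ∈ s, (A i ∩ A j).indicator (fun _ => (1 : ℝ)) ω ∂μ =
        ∑ i ∈ s, ∑ j ∈ s, μ.real (A i ∩ A j) :=
      Finset.sum_congr rfl fun i hi => by
        rw [integral_finsetSum _ fun j hj => ind _ ((hA i hi).inter (hA j hj))]
        exact Finset.sum_congr rfl fun j hj => by
          rw [integral_indicator_const _ ((hA i hi).inter (hA j hj))]; simp
    rw [e1, e2] at hnn
    simp only [smul_eq_mul, mul_one] at hnn
    linarith
  have := discrim_le_zero key
  unfold discrim at this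
  nlinarith

namespace SimpleGraph

/-! ### Probabilities of domination -/

section Domination

variable {V : Type*} [DecidableEq V] [Fintype V] (p : unitInterval)

theorem binomialRandom_real_exists_adj {x : V} {S : Finset V} (hx : x ∉ S) :
    (binomialRandom V p).real {G | ∃ s ∈ S, G.Adj x s} = 1 - (1 - p : ℝ) ^ S.card := by
  have h := probReal_compl_eq_one_sub (μ := binomialRandom V p)
    (MeasurableSet.of_discrete (s := {G : SimpleGraph V | ∀ u ∈ S, ¬ G.Adj x u}))
  rw [binomialRandom_real_forall_not_adj p hx] at h
  rw [← h]
  congr 1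
  ext G
  simp

theorem binomialRandom_real_exists_adj_and {x : V} {S T : Finset V} (hx : x ∉ S ∪ T) :
    (binomialRandom V p).real {G | (∃ s ∈ S, G.Adj x s) ∧ ∃ t ∈ T, G.Adj x t} =
      1 - (1 - p : ℝ) ^ S.card - (1 - p : ℝ) ^ T.card + (1 - p : ℝ) ^ (S ∪ T).card := by
  rw [Finset.mem_union, not_or] at hx
  have h := measureReal_union_add_inter (μ := binomialRandom V p)
    (s := {G : SimpleGraph V | ∃ s ∈ S, G.Adj x s})
    (MeasurableSet.of_discrete (s := {G : SimpleGraph V | ∃ t ∈ T, G.Adj x t}))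
  have hU : {G : SimpleGraph V | ∃ s ∈ S, G.Adj x s} ∪ {G | ∃ t ∈ T, G.Adj x t} =
      {G | ∃ s ∈ S ∪ T, G.Adj x s} := by
    ext G
    simp only [Set.mem_union, Set.mem_ofPred_eq, Finset.mem_union]
    grind
  rw [hU, binomialRandom_real_exists_adj p hx.1, binomialRandom_real_exists_adj p hx.2,
    binomialRandom_real_exists_adj p (by simp [hx])] at h
  have hI : {G : SimpleGraph V | (∃ s ∈ S, G.Adj x s) ∧ ∃ t ∈ T, G.Adj x t} =
    {G : SimpleGraph V | ∃ s ∈ S, G.Adj x s} ∩ {G | ∃ t ∈ T, G.Adj x t} := rfl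
  rw [hI]
  linarith

theorem binomialRandom_real_isDominatingSet (S : Finset V) :
    (binomialRandom V p).real {G | G.IsDominatingSet S} =
      (1 - (1 - p : ℝ) ^ S.card) ^ (Fintype.card V - S.card) := by
  have h := binomialRandom_real_forall_notMem p S (fun x => {G | ∃ s ∈ S, G.Adj x s}) (by
    rintro x - G H hGH ⟨s, hs, hxs⟩
    exact ⟨s, hs, (hGH s hs).1 hxs⟩)
  rw [Finset.prod_congr rfl fun x hx => binomialRandom_real_exists_adj p
    (by simpa using hx), Finset.prod_const, Finset.card_compl] at h
  rw [← h]
  congr 1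
  ext G
  simp [IsDominatingSet, or_iff_not_imp_left]

/-- Only an inequality, since the requirements on vertices of `S ∪ T` are dropped to keep
independence. -/
theorem binomialRandom_real_isDominatingSet_inter_le (S T : Finset V) :
    (binomialRandom V p).real ({G | G.IsDominatingSet S} ∩ {G | G.IsDominatingSet T}) ≤
      (1 - (1 - p : ℝ) ^ S.card - (1 - p : ℝ) ^ T.card + (1 - p : ℝ) ^ (S ∪ T).card) ^
        (Fintype.card V - (S ∪ T).card) := by
  have h := binomialRandom_real_forall_notMem p (S ∪ T)
    (fun x => {G | (∃ s ∈ S, G.Adj x s) ∧ ∃ t ∈ T, G.Adj x t}) (by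
      rintro x - G H hGH ⟨⟨s, hs, hxs⟩, t, ht, hxt⟩
      exact ⟨⟨s, hs, (hGH s (by simp [hs])).1 hxs⟩, t, ht, (hGH t (by simp [ht])).1 hxt⟩)
  rw [Finset.prod_congr rfl fun x hx => binomialRandom_real_exists_adj_and p
    (by simpa only [Finset.mem_compl] using hx), Finset.prod_const, Finset.card_compl] at h
  rw [← h]
  refine measureReal_mono ?_ (measure_ne_top _ _)
  rintro G ⟨h1, h2⟩ x hx
  rw [Finset.mem_union, not_or] at hx
  exact ⟨(h1 x).resolve_left (by simpa using hx.1), (h2 x).resolve_left (by simpa using hx.2)⟩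

end Domination

/-! ### Transversals and their overlaps -/

section Transversal

variable {V : Type*} [DecidableEq V] {d m : ℕ} (e : Fin d × Fin m ↪ V)

/-- The transversal of the disjoint blocks `e (i, ·)` that is picked out by `f`. -/
def transversal (f : Fin d → Fin m) : Finset V := Finset.univ.image fun i => e (i, f i)

theorem card_transversal (f : Fin d → Fin m) : (transversal e f).card = d := by
  rw [transversal, Finset.card_image_of_injective, Finset.card_fin]
  intro i j hij
  simpa using congrArg Prod.fst (e.injective hij)

theorem card_transversal_union (f g : Fin d → Fin m) :
    (transversal e f ∪ transversal e g).card =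
      2 * d - (Finset.univ.filter fun i => f i = g i).card := by
  have h : transversal e f ∩ transversal e g =
      (Finset.univ.filter fun i => f i = g i).image fun i => e (i, f i) := by
    ext v
    simp only [transversal, Finset.mem_inter, Finset.mem_image, Finset.mem_univ, true_and,
      Finset.mem_filter]
    constructor
    · rintro ⟨⟨i, rfl⟩, j, hj⟩
      have := e.injective hj
      rw [Prod.mk.injEq] at this
      obtain ⟨rfl, h2⟩ := this
      exact ⟨j, h2.symm, rfl⟩
    · rintro ⟨i, hi, rfl⟩
      exact ⟨⟨i, rfl⟩, i, by rw [hi]⟩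
  have hc : ((Finset.univ.filter fun i => f i = g i).image fun i => e (i, f i)).card =
      (Finset.univ.filter fun i => f i = g i).card :=
    Finset.card_image_of_injective _ fun i j hij => by
      simpa using congrArg Prod.fst (e.injective hij)
  rw [Finset.card_union, card_transversal, card_transversal, h, hc]
  omega

theorem sum_pow_card_agree (f : Fin d → Fin m) (z : ℝ) :
    ∑ g : Fin d → Fin m, z ^ (Finset.univ.filter fun i => f i = g i).card = (m - 1 + z) ^ d := by
  have h1 : ∀ g : Fin d → Fin m, z ^ (Finset.univ.filter fun i => f i = g i).card =
      ∏ i, if f i = g i then z else 1 := fun g => by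
    rw [Finset.prod_ite]; simp
  simp only [h1]
  have h2 := Finset.prod_univ_sum (fun _ : Fin d => (Finset.univ : Finset (Fin m)))
    (fun i b => if f i = b then z else (1 : ℝ))
  rw [Fintype.piFinset_univ] at h2
  rw [← h2]
  -- In each block one choice agrees with `f` and m - 1 do not.
  have h3 : ∀ i, ∑ b : Fin m, (if f i = b then z else (1 : ℝ)) = m - 1 + z := by
    intro i
    have : ∀ b : Fin m, (if f i = b then z else (1 : ℝ)) = (if f i = b then z - 1 else 0) + 1 := by
      intro b; split_ifs <;> ring
    simp only [this, Finset.sum_add_distrib, Finset.sum_ite_eq, Finset.mem_univ, if_true,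
      Finset.sum_const, Finset.card_univ, Fintype.card_fin, nsmul_eq_mul]
    ring
  simp [h3]

end Transversal

/-! ### Second moment bound for the domination number -/

/-- Correlation costs a factor exp(3L/4) per common vertex. This is geometric in the overlap j, as
`sum_pow_card_agree` requires, and stays below the block size, which is about e^L / d. -/
theorem pair_domination_bound {n d j : ℕ} {q L : ℝ} (hq0 : 0 ≤ q) (hq : q ≤ 1 / 2) (hd : 4 ≤ d)
    (hdn : 2 * d ≤ n) (hj : j ≤ d) (hL : 0 ≤ L) (hnq : n * q ^ d ≤ d * L / 2) :
    (1 - q ^ d - q ^ d + q ^ (2 * d - j)) ^ (n - (2 * d - j)) ≤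
      (1 - q ^ d) ^ (2 * n - 4 * d) * Real.exp (3 / 4 * L) ^ j := by
  have ha0 : 0 ≤ q ^ d := pow_nonneg hq0 _
  have ha : q ^ d ≤ 1 / 16 := by
    calc q ^ d ≤ q ^ 4 := pow_le_pow_of_le_one hq0 (by linarith) hd
      _ ≤ (1 / 2) ^ 4 := pow_le_pow_left₀ hq0 hq _
      _ = 1 / 16 := by norm_num
  have hexp : 2 * n - 4 * d = 2 * (n - 2 * d) := by omega
  rcases Nat.eq_zero_or_pos j with rfl | hj0
  · have hb : 1 - q ^ d - q ^ d + q ^ (2 * d - 0) = (1 - q ^ d) ^ 2 := by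
      rw [Nat.sub_zero, mul_comm 2 d, pow_mul]; ring
    rw [hb, hexp, pow_mul]
    simp
  · set b := q ^ (2 * d - j) with hb
    have hb0 : 0 ≤ b := pow_nonneg hq0 _
    have hbase0 : 0 ≤ 1 - q ^ d - q ^ d + b := by linarith
    -- The 3/2 compensates for (1 - q^d)² ≥ 2/3.
    have hbase : 1 - q ^ d - q ^ d + b ≤ (1 - q ^ d) ^ 2 * Real.exp (3 / 2 * b) := by
      have h1 : 3 / 2 * b + 1 ≤ Real.exp (3 / 2 * b) := Real.add_one_le_exp _
      have h2 : (2 / 3 : ℝ) ≤ (1 - q ^ d) ^ 2 := by nlinarith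
      calc 1 - q ^ d - q ^ d + b ≤ (1 - q ^ d) ^ 2 * (3 / 2 * b + 1) := by nlinarith
        _ ≤ _ := mul_le_mul_of_nonneg_left h1 (sq_nonneg _)
    have hnb : n * b ≤ j * L / 2 := by
      have h1 : b = q ^ d * q ^ (d - j) := by rw [hb, ← pow_add]; congr 1; omega
      have h2 : q ^ (d - j) ≤ (1 / 2) ^ (d - j) := pow_le_pow_left₀ hq0 hq _
      have h3 : (d : ℝ) * (1 / 2) ^ (d - j) ≤ j := by
        -- Uses j(d - j + 1) = d + (j - 1)(d - j), hence j ≥ 1.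
        have h4 : d ≤ j * 2 ^ (d - j) := by
          have h5 : d - j + 1 ≤ 2 ^ (d - j) := Nat.lt_two_pow_self
          calc d ≤ j * (d - j + 1) := by
                obtain ⟨i, rfl⟩ := Nat.exists_eq_add_of_le hj
                rw [Nat.add_sub_cancel_left]
                nlinarith
            _ ≤ _ := Nat.mul_le_mul_left _ h5
        have h4' : (d : ℝ) ≤ j * 2 ^ (d - j) := by exact_mod_cast h4
        rw [one_div, inv_pow, ← div_eq_mul_inv, div_le_iff₀ (by positivity)]
        exact h4'
      calc n * b = (n * q ^ d) * q ^ (d - j) := by rw [h1]; ring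
        _ ≤ (d * L / 2) * (1 / 2) ^ (d - j) :=
          mul_le_mul hnq h2 (pow_nonneg hq0 _) (by positivity)
        _ = (d * (1 / 2) ^ (d - j)) * (L / 2) := by ring
        _ ≤ j * (L / 2) := mul_le_mul_of_nonneg_right h3 (by positivity)
        _ = _ := by ring
    calc (1 - q ^ d - q ^ d + b) ^ (n - (2 * d - j))
        ≤ ((1 - q ^ d) ^ 2 * Real.exp (3 / 2 * b)) ^ (n - (2 * d - j)) :=
          pow_le_pow_left₀ hbase0 hbase _
      _ = ((1 - q ^ d) ^ 2) ^ (n - (2 * d - j)) * Real.exp (3 / 2 * b) ^ (n - (2 * d - j)) :=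
          mul_pow _ _ _
      _ ≤ ((1 - q ^ d) ^ 2) ^ (n - 2 * d) * Real.exp (3 / 2 * b) ^ n := by
          refine mul_le_mul ?_ ?_ (by positivity) (by positivity)
          · exact pow_le_pow_of_le_one (sq_nonneg _) (by nlinarith) (by omega)
          · exact pow_le_pow_right₀ (Real.one_le_exp (by positivity)) (by omega)
      _ ≤ _ := by
          rw [hexp, pow_mul]
          refine mul_le_mul_of_nonneg_left ?_ (by positivity)
          rw [← Real.exp_nat_mul, ← Real.exp_nat_mul, Real.exp_le_exp]
          linarith

theorem le_binomialRandom_real_dominationNumber_le {V : Type*} [DecidableEq V] [Fintype V]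
    (p : unitInterval) (hp : (1 / 2 : ℝ) ≤ p) {d m : ℕ} {L : ℝ} (hd : 4 ≤ d) (hm : 1 ≤ m)
    (hdm : d * m ≤ Fintype.card V) (hdn : 2 * d ≤ Fintype.card V) (hL : 0 ≤ L)
    (hnq : Fintype.card V * (1 - p : ℝ) ^ d ≤ d * L / 2) :
    1 - 2 * d * (1 - p : ℝ) ^ d - d * (Real.exp (3 / 4 * L) / m) ≤
      (binomialRandom V p).real {G | G.dominationNumber ≤ d} := by
  classical
  have hp1 : (p : ℝ) ≤ 1 := p.2.2
  obtain ⟨e⟩ : Nonempty (Fin d × Fin m ↪ V) :=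
    Function.Embedding.nonempty_of_card_le (by simpa using hdm)
  set n := Fintype.card V with hn
  set q : ℝ := 1 - p with hq
  have hq0 : 0 ≤ q := by linarith
  have hq2 : q ≤ 1 / 2 := by linarith
  have ha0 : 0 ≤ q ^ d := pow_nonneg hq0 _
  have ha : q ^ d ≤ 1 / 2 := by
    calc q ^ d ≤ q ^ 1 := pow_le_pow_of_le_one hq0 (by linarith) (by omega)
      _ ≤ 1 / 2 := by simpa using hq2
  set z := Real.exp (3 / 4 * L) with hz
  have hz1 : 1 ≤ z := Real.one_le_exp (by positivity)
  have hm' : (1 : ℝ) ≤ m := by exact_mod_cast hm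
  set A : (Fin d → Fin m) → Set (SimpleGraph V) :=
    fun f => {G | G.IsDominatingSet (transversal e f)} with hA
  set P := (binomialRandom V p).real (⋃ f ∈ Finset.univ, A f) with hP
  have hmono : P ≤ (binomialRandom V p).real {G | G.dominationNumber ≤ d} := by
    refine measureReal_mono ?_ (measure_ne_top _ _)
    intro G hG
    simp only [Finset.mem_univ, Set.iUnion_true, Set.mem_iUnion] at hG
    obtain ⟨f, hf⟩ := hG
    change (⨅ (S : Set V) (_ : G.IsDominatingSet S), S.encard) ≤ d
    refine iInf₂_le_of_le _ hf ?_
    rw [Set.encard_coe_eq_coe_finsetCard, card_transversal]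
  refine le_trans ?_ hmono
  have h2 := sq_sum_measureReal_le (binomialRandom V p) Finset.univ A
    (fun _ _ => MeasurableSet.of_discrete)
  have hfirst : ∑ f, (binomialRandom V p).real (A f) = (m : ℝ) ^ d * (1 - q ^ d) ^ (n - d) := by
    simp [hA, binomialRandom_real_isDominatingSet, card_transversal, ← hq, ← hn]
  have hsecond : ∑ f, ∑ g, (binomialRandom V p).real (A f ∩ A g) ≤
      (m : ℝ) ^ d * ((1 - q ^ d) ^ (2 * n - 4 * d) * (m - 1 + z) ^ d) := by
    calc _ ≤ ∑ f : Fin d → Fin m, ∑ g : Fin d → Fin m, (1 - q ^ d) ^ (2 * n - 4 * d) *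
          z ^ (Finset.univ.filter fun i => f i = g i).card := by
          refine Finset.sum_le_sum fun f _ => Finset.sum_le_sum fun g _ => ?_
          refine (binomialRandom_real_isDominatingSet_inter_le p _ _).trans ?_
          rw [card_transversal, card_transversal, card_transversal_union]
          exact pair_domination_bound hq0 hq2 hd hdn
            ((Finset.card_le_univ _).trans (by simp)) hL hnq
      _ = _ := by
          simp [← Finset.mul_sum, sum_pow_card_agree]
  rw [hfirst] at h2
  have hP0 : 0 ≤ P := measureReal_nonneg
  have hc : 0 < (1 - q ^ d) := by linarith
  have h3 : ((1 - q ^ d) ^ (2 * d)) * (m : ℝ) ^ d ≤ P * (m - 1 + z) ^ d := by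
    have hpos : 0 < (m : ℝ) ^ d * (1 - q ^ d) ^ (2 * n - 4 * d) := by positivity
    refine le_of_mul_le_mul_left ?_ hpos
    calc (m : ℝ) ^ d * (1 - q ^ d) ^ (2 * n - 4 * d) * ((1 - q ^ d) ^ (2 * d) * (m : ℝ) ^ d)
        = ((m : ℝ) ^ d * (1 - q ^ d) ^ (n - d)) ^ 2 := by
          -- The surplus 2d is the price of ignoring the vertices of both transversals.
          have : (n - d) * 2 = (2 * n - 4 * d) + 2 * d := by omega
          rw [mul_pow, ← pow_mul (1 - q ^ d), this, pow_add]
          ring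
      _ ≤ P * ((m : ℝ) ^ d * ((1 - q ^ d) ^ (2 * n - 4 * d) * (m - 1 + z) ^ d)) :=
          h2.trans (mul_le_mul_of_nonneg_left hsecond hP0)
      _ = _ := by ring
  have hmz : 0 < (m : ℝ) - 1 + z := by linarith
  set v := (m : ℝ) / (m - 1 + z) with hv
  have h4 : (1 - q ^ d) ^ (2 * d) * v ^ d ≤ P := by
    rw [hv, div_pow, ← mul_div_assoc, div_le_iff₀ (by positivity)]
    exact h3
  have hv0 : 0 ≤ v := by positivity
  have hv1 : v ≤ 1 := by rw [hv, div_le_one hmz]; linarith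
  have hvz : 1 - z / m ≤ v := by
    rw [hv, le_div_iff₀ hmz]
    have : z / m * m = z := by field_simp
    have hzm : 0 ≤ z / m := by positivity
    nlinarith
  have hvd : 1 - d * (z / m) ≤ v ^ d := by
    have h := one_add_mul_le_pow (a := v - 1) (by linarith) d
    rw [add_sub_cancel] at h
    have hd0 : (0 : ℝ) ≤ d := Nat.cast_nonneg d
    nlinarith
  have hud : 1 - 2 * d * q ^ d ≤ (1 - q ^ d) ^ (2 * d) := by
    have h := one_add_mul_le_pow (a := -q ^ d) (by linarith) (2 * d)
    rw [← sub_eq_add_neg] at h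
    push_cast at h
    linarith
  have hu1 : (1 - q ^ d) ^ (2 * d) ≤ 1 := pow_le_one₀ hc.le (by linarith)
  have hvd1 : v ^ d ≤ 1 := pow_le_one₀ hv0 hv1
  nlinarith

/-! ### Choice of r and comparison of the two bounds -/

theorem le_conflictFreeChromaticNumber {V : Type*} {G : SimpleGraph V} {r : ℕ}
    (h : ¬ ∃ c : V → Fin r, G.IsConflictFree c) :
    ((r + 1 : ℕ) : ℕ∞) ≤ G.conflictFreeChromaticNumber := by
  refine le_iInf₂ fun k hk => ?_
  obtain ⟨c, hc⟩ := hk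
  rw [Nat.cast_le]
  by_contra hlt
  refine h ⟨fun v => Fin.castLE (by omega) (c v), fun x => ?_⟩
  obtain ⟨y, hy, hyz⟩ := hc x
  exact ⟨y, hy, fun z hz hzy he => hyz z hz hzy (Fin.castLE_injective _ he)⟩

theorem union_bound_le_exp {n r : ℕ} {q L : ℝ} (hq0 : 0 ≤ q) (hq1 : q ≤ 1) (hr : 1 ≤ r)
    (hL : 0 ≤ L) (hn : (n + 1 : ℝ) = Real.exp L) (hrn : 42 * r ≤ n)
    (h : 7 / 2 * r * L ≤ n * q ^ r) :
    ((n + 1 : ℝ) ^ 3) ^ r * (1 - q ^ r) ^ (n - 3 * r) ≤ Real.exp (-(L / 4)) := by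
  have ha0 : 0 ≤ q ^ r := pow_nonneg hq0 _
  have ha1 : q ^ r ≤ 1 := pow_le_one₀ hq0 hq1
  have hr' : (1 : ℝ) ≤ r := by exact_mod_cast hr
  have hrn' : (42 : ℝ) * r ≤ n := by exact_mod_cast hrn
  have h1 : (1 - q ^ r) ^ (n - 3 * r) ≤ Real.exp (-q ^ r) ^ (n - 3 * r) :=
    pow_le_pow_left₀ (by linarith) (Real.one_sub_le_exp_neg _) _
  calc ((n + 1 : ℝ) ^ 3) ^ r * (1 - q ^ r) ^ (n - 3 * r)
      ≤ (Real.exp L ^ 3) ^ r * Real.exp (-q ^ r) ^ (n - 3 * r) := by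
        rw [hn]; exact mul_le_mul_of_nonneg_left h1 (by positivity)
    _ = Real.exp (r * (3 * L) + (n - 3 * r) * (-q ^ r)) := by
        rw [← Real.exp_nat_mul, ← Real.exp_nat_mul, ← Real.exp_nat_mul, ← Real.exp_add,
          Nat.cast_sub (by omega)]
        push_cast
        rfl
    _ ≤ _ := by
        rw [Real.exp_le_exp]
        -- By 42r ≤ n, 3r is at most n/14; then (13/14)(7/2) = 13/4 beats the entropy coefficient 3
        -- by 1/4.
        have h2 : (13 / 14 : ℝ) * (n * q ^ r) ≤ (n - 3 * r) * q ^ r := by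
          have : (13 / 14 : ℝ) * n ≤ n - 3 * r := by linarith
          nlinarith
        nlinarith

/-- The crossover between the expected number of vertices that `r` singletons fail to dominate and
the entropy of the choice of `r` sets of bounded size. -/
theorem exists_crossover {n : ℕ} {q L : ℝ} (hn0 : 1 ≤ n) (hq0 : 0 ≤ q) (hq : q ≤ 1 / 2)
    (hn : (n + 1 : ℝ) = Real.exp L) :
    ∃ r : ℕ, (r : ℝ) ≤ 2 * L ∧ 7 / 2 * r * L ≤ n * q ^ r ∧
      n * q ^ (r + 1) < 7 / 2 * (r + 1 : ℝ) * L := by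
  have hn0' : (1 : ℝ) ≤ n := by exact_mod_cast hn0
  have hlog2 := Real.log_two_gt_d9
  have hL : Real.log 2 ≤ L := by
    rw [← Real.log_exp L, ← hn]
    exact Real.log_le_log (by norm_num) (by linarith)
  -- For r ≥ 1 the hypothesis forces 2^r ≤ n, and log 2 > 1/2.
  have bound : ∀ r : ℕ, 7 / 2 * r * L ≤ n * q ^ r → (r : ℝ) ≤ 2 * L := by
    intro r hr
    rcases Nat.eq_zero_or_pos r with rfl | hr0
    · simp; linarith
    · have hr1 : (1 : ℝ) ≤ r := by exact_mod_cast hr0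
      have h1 : (1 : ℝ) ≤ n * (1 / 2) ^ r := by
        calc (1 : ℝ) ≤ 7 / 2 * r * L := by nlinarith
          _ ≤ n * q ^ r := hr
          _ ≤ _ := mul_le_mul_of_nonneg_left (pow_le_pow_left₀ hq0 hq _) (by linarith)
      have h2 : (2 : ℝ) ^ r ≤ n := by
        rw [one_div, inv_pow, ← div_eq_mul_inv, one_le_div (by positivity)] at h1
        exact h1
      have h3 : r * Real.log 2 ≤ L := by
        rw [← Real.log_pow, ← Real.log_exp L, ← hn]
        exact Real.log_le_log (by positivity) (by linarith)
      nlinarith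
  -- Without a crossover the inequality would propagate from r = 0 to all r, against `bound`.
  by_contra hcon
  push Not at hcon
  have hall : ∀ r : ℕ, 7 / 2 * r * L ≤ n * q ^ r := by
    intro r
    induction r with
    | zero => simp
    | succ r ih =>
      have := hcon r (bound r ih) ih
      push_cast
      exact this
  obtain ⟨r, hr⟩ := exists_nat_gt (2 * L)
  exact absurd (bound r (hall r)) (not_le.2 hr)

theorem le_binomialRandom_real_dominationNumber_le_conflictFreeChromaticNumber_add_three
    {n : ℕ} (p : unitInterval) (hp : (1 / 2 : ℝ) ≤ p) {L : ℝ} (hn : (n + 1 : ℝ) = Real.exp L)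
    (hL : 0 ≤ L) (hn0 : 42 * (2 * L + 4) ≤ n) :
    1 - (1 + 2 * (2 * L + 4) ^ 2 * L + 4 * (2 * L + 4) ^ 2) * Real.exp (-(L / 4)) ≤
      (binomialRandom (Fin n) p).real {G : SimpleGraph (Fin n) |
        G.dominationNumber ≤ G.conflictFreeChromaticNumber + 3} := by
  have hp1 : (p : ℝ) ≤ 1 := p.2.2
  have hnpos : (1 : ℝ) ≤ n := by linarith
  have hn1 : 1 ≤ n := by exact_mod_cast hnpos
  set q : ℝ := 1 - p with hq
  have hq0 : 0 ≤ q := by linarith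
  have hq2 : q ≤ 1 / 2 := by linarith
  obtain ⟨r, hrL, hr1, hr2⟩ := exists_crossover hn1 hq0 hq2 hn
  have hsub : {G : SimpleGraph (Fin n) | G.dominationNumber ≤ ((r + 4 : ℕ) : ℕ∞)} \
      {G | ∃ c : Fin n → Fin r, G.IsConflictFree c} ⊆
        {G | G.dominationNumber ≤ G.conflictFreeChromaticNumber + 3} := by
    rintro G ⟨h1, h2⟩
    have h3 := le_conflictFreeChromaticNumber h2
    calc G.dominationNumber ≤ ((r + 4 : ℕ) : ℕ∞) := h1
      _ = ((r + 1 : ℕ) : ℕ∞) + 3 := by push_cast; rw [add_assoc]; norm_num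
      _ ≤ _ := by gcongr
  refine le_trans ?_ ((le_measureReal_sdiff (μ := binomialRandom (Fin n) p)).trans
    (measureReal_mono hsub (measure_ne_top _ _)))
  have hCF : (binomialRandom (Fin n) p).real {G | ∃ c : Fin n → Fin r, G.IsConflictFree c} ≤
      Real.exp (-(L / 4)) := by
    -- The union bound gains only exp(-rL/4), so r = 0 is separate.
    rcases Nat.eq_zero_or_pos r with rfl | hr0
    · have : {G : SimpleGraph (Fin n) | ∃ c : Fin n → Fin 0, G.IsConflictFree c} = ∅ := by
        ext G
        simp only [Set.mem_ofPred_eq, Set.mem_empty_iff_false, iff_false]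
        rintro ⟨c, -⟩
        exact (c ⟨0, hn1⟩).elim0
      rw [this, measureReal_empty]
      positivity
    · have h := binomialRandom_real_exists_isConflictFree_le (V := Fin n) p hp r
      rw [Fintype.card_fin, ← hq] at h
      refine h.trans (union_bound_le_exp hq0 (by linarith) hr0 hL hn ?_ hr1)
      have : (42 : ℝ) * r ≤ n := by linarith
      exact_mod_cast this
  set d := r + 4 with hd
  have hdr : (d : ℝ) = r + 4 := by rw [hd]; push_cast; rfl
  have hr0 : (0 : ℝ) ≤ r := Nat.cast_nonneg r
  have hdL : (d : ℝ) ≤ 2 * L + 4 := by linarith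
  have hdpos : (0 : ℝ) < d := by linarith
  have hdn : (2 : ℝ) * d ≤ n := by nlinarith
  have hdn' : 2 * d ≤ n := by exact_mod_cast hdn
  -- The additive 3 is spent here: q³ ≤ 1/8 turns the crossover constant 7/2 into 7/16 < 1/2.
  have hnq : n * q ^ d ≤ d * L / 2 := by
    have h8 : q ^ 3 ≤ 1 / 8 := by
      calc q ^ 3 ≤ (1 / 2) ^ 3 := pow_le_pow_left₀ hq0 hq2 _
        _ = 1 / 8 := by norm_num
    calc n * q ^ d = (n * q ^ (r + 1)) * q ^ 3 := by rw [hd]; ring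
      _ ≤ (7 / 2 * (r + 1 : ℝ) * L) * (1 / 8) :=
        mul_le_mul hr2.le h8 (pow_nonneg hq0 _) (by positivity)
      _ ≤ d * L / 2 := by rw [hdr]; nlinarith
  have hm : (n : ℝ) / (2 * d) ≤ (n / d : ℕ) := by
    have h1 : n < (n / d + 1) * d := by
      have := Nat.lt_div_mul_add (a := n) (b := d) (by omega)
      linarith
    have h1' : (n : ℝ) < ((n / d : ℕ) + 1) * d := by exact_mod_cast h1
    rw [div_le_iff₀ (by positivity)]
    nlinarith
  have hm1 : 1 ≤ n / d := (Nat.one_le_div_iff (by omega)).2 (by omega)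
  have hD := le_binomialRandom_real_dominationNumber_le (V := Fin n) p hp (d := d) (m := n / d)
    (L := L) (by omega) hm1 (by simpa using Nat.mul_div_le n d) (by simpa using hdn') hL
    (by simpa using hnq)
  rw [← hq] at hD
  have hE : Real.exp L ≤ 2 * n := by rw [← hn]; linarith
  have hE1 : 1 / (n : ℝ) ≤ 2 * Real.exp (-L) := by
    rw [Real.exp_neg, ← div_eq_mul_inv, div_le_div_iff₀ (by linarith) (Real.exp_pos _)]
    linarith
  have hexp : Real.exp (-L) ≤ Real.exp (-(L / 4)) := Real.exp_le_exp.2 (by linarith)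
  have hdd : (d : ℝ) ^ 2 ≤ (2 * L + 4) ^ 2 := pow_le_pow_left₀ hdpos.le hdL _
  have hB1 : 2 * d * q ^ d ≤ 2 * (2 * L + 4) ^ 2 * L * Real.exp (-(L / 4)) := by
    have h1 : q ^ d ≤ (d * L / 2) * (1 / n) := by
      rw [mul_one_div, le_div_iff₀ (by linarith)]
      linarith
    calc 2 * d * q ^ d ≤ 2 * d * ((d * L / 2) * (1 / n)) :=
          mul_le_mul_of_nonneg_left h1 (by positivity)
      _ = d ^ 2 * L * (1 / n) := by ring
      _ ≤ (2 * L + 4) ^ 2 * L * (2 * Real.exp (-(L / 4))) := by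
          gcongr
          linarith
      _ = _ := by ring
  have hB2 : d * (Real.exp (3 / 4 * L) / (n / d : ℕ)) ≤
      4 * (2 * L + 4) ^ 2 * Real.exp (-(L / 4)) := by
    calc d * (Real.exp (3 / 4 * L) / (n / d : ℕ))
        ≤ d * (Real.exp (3 / 4 * L) / (n / (2 * d))) := by gcongr
      _ = 2 * d ^ 2 * Real.exp (3 / 4 * L) * (1 / n) := by field_simp
      _ ≤ 2 * (2 * L + 4) ^ 2 * Real.exp (3 / 4 * L) * (2 * Real.exp (-L)) := by gcongr
      _ = 4 * (2 * L + 4) ^ 2 * (Real.exp (3 / 4 * L) * Real.exp (-L)) := by ring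
      _ = _ := by rw [← Real.exp_add]; congr 2; ring
  linarith

/-! ### Passage to the limit -/

open Filter in
theorem tendsto_mul_exp_neg_div_four :
    Tendsto (fun L : ℝ => (1 + 2 * (2 * L + 4) ^ 2 * L + 4 * (2 * L + 4) ^ 2) *
      Real.exp (-(L / 4))) atTop (nhds 0) := by
  have hy : Tendsto (fun L : ℝ => L / 4) atTop atTop := tendsto_id.atTop_div_const (by norm_num)
  have h : ∀ k, Tendsto (fun L : ℝ => (L / 4) ^ k * Real.exp (-(L / 4))) atTop (nhds 0) := fun k =>
    (Real.tendsto_pow_mul_exp_neg_atTop_nhds_zero k).comp hy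
  -- Coefficients of the polynomial factor expanded in powers of L/4.
  have hs := (((h 0).const_mul 65).add ((h 1).const_mul 384)).add
    (((h 2).const_mul 768).add ((h 3).const_mul 512))
  simp only [mul_zero, add_zero] at hs
  refine hs.congr fun L => ?_
  ring

open Filter in
theorem eventually_linear_le_exp :
    ∀ᶠ L : ℝ in atTop, 42 * (2 * L + 4) + 1 ≤ Real.exp L := by
  have h : ∀ k, Tendsto (fun L : ℝ => L ^ k * Real.exp (-L)) atTop (nhds 0) :=
    Real.tendsto_pow_mul_exp_neg_atTop_nhds_zero
  have hs := ((h 0).const_mul 169).add ((h 1).const_mul 84)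
  simp only [mul_zero, add_zero] at hs
  filter_upwards [hs.eventually (ge_mem_nhds (by norm_num : (0 : ℝ) < 1))] with L hL
  have hL' : (42 * (2 * L + 4) + 1) * Real.exp (-L) ≤ 1 := by
    refine le_trans (le_of_eq ?_) hL
    ring
  rwa [Real.exp_neg, ← div_eq_mul_inv, div_le_one (Real.exp_pos _)] at hL'

open Filter in
theorem tendsto_binomialRandom_dominationNumber_le (p : ℕ → unitInterval)
    (hp : ∀ n, (1 / 2 : ℝ) ≤ (p n : ℝ)) :
    Tendsto (fun n : ℕ => binomialRandom (Fin n) (p n) {G : SimpleGraph (Fin n) |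
      G.dominationNumber ≤ G.conflictFreeChromaticNumber + 3}) atTop (nhds 1) := by
  have hlog : Tendsto (fun n : ℕ => Real.log (n + 1 : ℝ)) atTop atTop :=
    Real.tendsto_log_atTop.comp (tendsto_atTop_add_const_right _ _ tendsto_natCast_atTop_atTop)
  have hlow := (tendsto_mul_exp_neg_div_four.comp hlog).const_sub 1
  rw [sub_zero] at hlow
  have hreal : Tendsto (fun n : ℕ => (binomialRandom (Fin n) (p n)).real
      {G : SimpleGraph (Fin n) | G.dominationNumber ≤ G.conflictFreeChromaticNumber + 3})
      atTop (nhds 1) := by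
    refine tendsto_of_tendsto_of_tendsto_of_le_of_le' hlow tendsto_const_nhds ?_
      (Eventually.of_forall fun n => measureReal_le_one)
    filter_upwards [hlog.eventually eventually_linear_le_exp] with n hn
    have hexp : (n + 1 : ℝ) = Real.exp (Real.log (n + 1)) := by
      rw [Real.exp_log (by positivity)]
    have hL : 0 ≤ Real.log (n + 1 : ℝ) := Real.log_nonneg (by simp)
    rw [← hexp] at hn
    exact le_binomialRandom_real_dominationNumber_le_conflictFreeChromaticNumber_add_three
      (p n) (hp n) hexp hL (by linarith)
  have := (ENNReal.continuous_ofReal.tendsto 1).comp hreal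
  rw [ENNReal.ofReal_one] at this
  refine this.congr fun n => ?_
  simp

end SimpleGraph

theorem theorem2 :
    (∀ {V : Type*} (G : SimpleGraph V),
      G.conflictFreeChromaticNumber ≤ G.dominationNumber + 1) ∧
    (∀ p : ℕ → unitInterval, (∀ n, (1 / 2 : ℝ) ≤ (p n : ℝ)) →
      Filter.Tendsto
        (fun n : ℕ => SimpleGraph.binomialRandom (Fin n) (p n)
          {G : SimpleGraph (Fin n) |
            G.dominationNumber ≤ G.conflictFreeChromaticNumber + 3})
        Filter.atTop (nhds 1)) :=
  ⟨fun G => G.conflictFreeChromaticNumber_le_dominationNumber_add_one,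
    SimpleGraph.tendsto_binomialRandom_dominationNumber_le⟩
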